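/- Let $1\le\mu\le n$ be integers and let $P(z)=a_nz^n+\sum_{j=\mu}^{n}a_{n-j}z^{n-j}$ be a complex polynomial of degree $n$ having all its zeros in $|z|\le k$, where $0\le k\le 1$. Put $m=\min_{|z|=k}|P(z)|$ and, for $\alpha\in\mathbb C$, let $D_\alpha P(z)=nP(z)+(\alpha-z)P'(z)$ be the polar derivative of $P$. (If $k=0$, then $m=0$, and $m/k^{n-\mu}$ is read as $0$.) Then for all $\alpha,\beta\in\mathbb C$ with $|\alpha|\ge k^{\mu}$ and $|\beta|\le 1$ and every real $p>0$, $$n\,(|\alpha|-k^{\mu})\left(\int_0^{2\pi}\left|\frac{P(e^{i\theta})+\frac{m\beta}{k^{n-\mu}}}{|D_\alpha P(e^{i\theta})|-\frac{nm}{k^{n-\mu}}}\right|^p d\theta\right)^{1/p}\le\left(\int_0^{2\pi}\left|1+k^{\mu}e^{i\theta}\right|^p d\theta\right)^{1/p}.$$ When $|\alpha|>k^{\mu}$, the denominator on the left is nonzero for almost every $\theta$ and the integral on the left is finite; when $|\alpha|=k^{\mu}$, the left-hand side is read as $0$. -/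

import Mathlib

open Polynomial

/-- The polar derivative `D_α P (z) = n P(z) + (α - z) P'(z)`, where `n` is the degree of `P`. -/
noncomputable def polarDerivative (α : ℂ) (P : ℂ[X]) : ℂ[X] :=
  C (P.natDegree : ℂ) * P + (C α - X) * derivative P

/-- The point `e^{iθ}` of the unit circle. -/
noncomputable def unitPoint (θ : ℝ) : ℂ := Complex.exp ((θ : ℂ) * Complex.I)

/-! Pass to the reversal `f(w) = w^n P(1/w)`, which has no zero in `k|w| < 1`, and put `B = n f - w
f'`, `c = m / k^(n-μ)`. For `|z| = 1` and `w = 1/z`, `z P'(z) = z^n B(w)` and `D_α P(z) = z^n (w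
f'(w) + α w B(w))`. Everything rests on `|w f'| + n c |w|^μ ≤ (k|w|)^μ |B|` in the unit disc
(`norm_X_mul_derivative_add_le`): the logarithmic derivative gives `|w f'| ≤ |B|`, the zero of order
at least `μ` of `w f'` at `0` sharpens this as in Schwarz's lemma, and perturbing `f` by constants
brings in `m`. Hence `|D_α P| - n c ≥ (|α| - k^μ) |B|`. Also `n (P + c β) = z^n (A + B)` with `A = w
f' + n c β w^n` and `|A/B| ≤ k^μ |w|`. So `n (|α| - k^μ)` times the modulus of the quotient is at
most `|1 + A/B|`, and Littlewood subordination for `(1 + z)^p` bounds its `p`-mean by that of `1 +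
k^μ z` (`integral_norm_one_add_div_rpow_le`). -/

/-! ### Logarithmic derivatives and the coderivative. -/

theorem re_mul_one_div_sub_le {z r : ℂ} (h : ‖z‖ < ‖r‖) : (z * (1 / (z - r))).re ≤ 1 / 2 := by
  have hne : z - r ≠ 0 := by
    intro h0
    rw [sub_eq_zero.mp h0] at h
    exact lt_irrefl _ h
  have hpos : 0 < Complex.normSq (z - r) := Complex.normSq_pos.mpr hne
  have hsq : Complex.normSq z < Complex.normSq r := by
    rw [Complex.normSq_eq_norm_sq, Complex.normSq_eq_norm_sq]
    exact pow_lt_pow_left₀ h (norm_nonneg _) two_ne_zero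
  have hre : (z * (1 / (z - r))).re
      = (z.re * (z - r).re + z.im * (z - r).im) / Complex.normSq (z - r) := by
    rw [mul_one_div, Complex.div_re]
    ring
  rw [hre, div_le_iff₀ hpos]
  simp only [Complex.normSq_apply, Complex.sub_re, Complex.sub_im] at *
  nlinarith

/-- `z f'/f` is the sum of `z/(z - r)` over the at most `n` roots, each of real part at most `1/2`.
-/
theorem re_mul_derivative_div_le {f : ℂ[X]} {n : ℕ} (hdeg : f.natDegree ≤ n) {z : ℂ}
    (hz : f.eval z ≠ 0) (h : ∀ r, f.IsRoot r → ‖z‖ < ‖r‖) :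
    (z * (f.derivative.eval z / f.eval z)).re ≤ n / 2 := by
  rw [(IsAlgClosed.splits f).eval_derivative_div_eval_of_ne_zero hz]
  have key : ∀ s : Multiset ℂ, (∀ r ∈ s, ‖z‖ < ‖r‖) →
      (z * (s.map fun r ↦ 1 / (z - r)).sum).re ≤ s.card / 2 := by
    intro s
    induction s using Multiset.induction_on with
    | empty => simp
    | cons r s ih =>
      intro hs
      have h1 := ih fun t ht ↦ hs t (Multiset.mem_cons_of_mem ht)
      have h2 := re_mul_one_div_sub_le (hs r (Multiset.mem_cons_self r s))
      rw [Multiset.map_cons, Multiset.sum_cons, mul_add, Complex.add_re, Multiset.card_cons]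
      push_cast
      linarith
  refine (key f.roots fun r hr ↦ h r (isRoot_of_mem_roots hr)).trans ?_
  have : (f.roots.card : ℝ) ≤ n := by exact_mod_cast f.card_roots'.trans hdeg
  linarith

theorem norm_le_norm_sub_of_re_le {w : ℂ} {n : ℝ} (hn : 0 ≤ n) (h : w.re ≤ n / 2) :
    ‖w‖ ≤ ‖(n : ℂ) - w‖ := by
  refine le_of_sq_le_sq ?_ (norm_nonneg _)
  rw [← Complex.normSq_eq_norm_sq, ← Complex.normSq_eq_norm_sq]
  simp only [Complex.normSq_apply, Complex.sub_re, Complex.sub_im, Complex.ofReal_re,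
    Complex.ofReal_im]
  nlinarith

/-- `n f - X f'`; if `f` is the reversal of `P` with respect to `n`, this is the reversal
of `X P'`. -/
noncomputable def coderivative (n : ℕ) (f : ℂ[X]) : ℂ[X] := C (n : ℂ) * f - X * derivative f

theorem eval_coderivative (n : ℕ) (f : ℂ[X]) (z : ℂ) :
    (coderivative n f).eval z = n * f.eval z - z * f.derivative.eval z := by
  simp [coderivative]

/-! ### Bounds for polynomials without zeros in `k|z| < 1`. -/

section ZeroFree

variable {f : ℂ[X]} {n : ℕ} {k : ℝ} {z : ℂ}

theorem norm_lt_norm_of_isRoot (hk : 0 ≤ k) (hf : ∀ z : ℂ, k * ‖z‖ < 1 → f.eval z ≠ 0)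
    (hz : k * ‖z‖ < 1) (r : ℂ) (hr : f.IsRoot r) : ‖z‖ < ‖r‖ :=
  lt_of_mul_lt_mul_left (hz.trans_le (not_lt.mp fun h ↦ hf r h hr)) hk

/-- A zero would force `z f'/f = n`, whose real part exceeds `n/2`. -/
theorem coderivative_eval_ne_zero (hk : 0 ≤ k) (hn : 0 < n) (hdeg : f.natDegree ≤ n)
    (hf : ∀ z : ℂ, k * ‖z‖ < 1 → f.eval z ≠ 0) (hz : k * ‖z‖ < 1) :
    (coderivative n f).eval z ≠ 0 := by
  intro h0
  have h := re_mul_derivative_div_le hdeg (hf z hz) (norm_lt_norm_of_isRoot hk hf hz)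
  rw [eval_coderivative, sub_eq_zero] at h0
  rw [← mul_div_assoc, ← h0, mul_div_cancel_right₀ _ (hf z hz), Complex.natCast_re] at h
  have : (0 : ℝ) < n := by exact_mod_cast hn
  linarith

theorem norm_X_mul_derivative_le (hk : 0 ≤ k) (hdeg : f.natDegree ≤ n)
    (hf : ∀ z : ℂ, k * ‖z‖ < 1 → f.eval z ≠ 0) (hz : k * ‖z‖ < 1) :
    ‖z * f.derivative.eval z‖ ≤ ‖(coderivative n f).eval z‖ := by
  have h := norm_le_norm_sub_of_re_le n.cast_nonneg
    (re_mul_derivative_div_le hdeg (hf z hz) (norm_lt_norm_of_isRoot hk hf hz))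
  have hfz := hf z hz
  calc ‖z * f.derivative.eval z‖
      = ‖z * (f.derivative.eval z / f.eval z)‖ * ‖f.eval z‖ := by
        rw [← norm_mul, mul_assoc, div_mul_cancel₀ _ hfz]
    _ ≤ ‖((n : ℝ) : ℂ) - z * (f.derivative.eval z / f.eval z)‖ * ‖f.eval z‖ := by gcongr
    _ = _ := by
        rw [← norm_mul, eval_coderivative, sub_mul, mul_assoc, div_mul_cancel₀ _ hfz]
        simp

/-- Maximum principle for `z f' / (z^μ B)`, `B` the coderivative, on the disc of radius `1/x`, then
`x → k`. Taking `x > k` keeps `B` zero-free on the closed disc and covers `k = 0`. -/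
theorem norm_X_mul_derivative_le_pow {μ : ℕ} (hk : 0 ≤ k) (hn : 0 < n) (hdeg : f.natDegree ≤ n)
    (hf : ∀ z : ℂ, k * ‖z‖ < 1 → f.eval z ≠ 0) (hμ : X ^ μ ∣ X * derivative f)
    (hz : k * ‖z‖ < 1) :
    ‖z * f.derivative.eval z‖ ≤ (k * ‖z‖) ^ μ * ‖(coderivative n f).eval z‖ := by
  obtain ⟨g, hg⟩ := hμ
  have hge : ∀ w : ℂ, w * f.derivative.eval w = w ^ μ * g.eval w := fun w ↦ by
    simpa using congrArg (eval w) hg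
  have step : ∀ x : ℝ, k < x → x * ‖z‖ < 1 →
      ‖z * f.derivative.eval z‖ ≤ (x * ‖z‖) ^ μ * ‖(coderivative n f).eval z‖ := by
    intro x hx hxz
    have hx0 : 0 < x := hk.trans_lt hx
    have hin : ∀ w ∈ Metric.closedBall (0 : ℂ) x⁻¹, k * ‖w‖ < 1 := fun w hw ↦ by
      rw [mem_closedBall_zero_iff] at hw
      calc k * ‖w‖ ≤ k * x⁻¹ := by gcongr
        _ < x * x⁻¹ := by gcongr
        _ = 1 := mul_inv_cancel₀ hx0.ne'
    have hB : ∀ w ∈ Metric.closedBall (0 : ℂ) x⁻¹, (coderivative n f).eval w ≠ 0 := fun w hw ↦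
      coderivative_eval_ne_zero hk hn hdeg hf (hin w hw)
    have hr0 : x⁻¹ ≠ 0 := (inv_pos.mpr hx0).ne'
    have hd : DiffContOnCl ℂ (fun w ↦ g.eval w / (coderivative n f).eval w)
        (Metric.ball 0 x⁻¹) := by
      refine DifferentiableOn.diffContOnCl ?_
      rw [closure_ball _ hr0]
      exact g.differentiable.differentiableOn.fun_div
        (coderivative n f).differentiable.differentiableOn hB
    have hz' : z ∈ closure (Metric.ball (0 : ℂ) x⁻¹) := by
      rw [closure_ball _ hr0, mem_closedBall_zero_iff, ← one_div, le_div_iff₀ hx0, mul_comm]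
      exact hxz.le
    have hmax := Complex.norm_le_of_forall_mem_frontier_norm_le Metric.isBounded_ball hd
      (C := x ^ μ) ?_ hz'
    · rw [closure_ball _ hr0] at hz'
      have hBz := norm_pos_iff.mpr (hB z hz')
      rw [norm_div, div_le_iff₀ hBz] at hmax
      rw [hge, norm_mul, norm_pow, mul_pow, mul_comm (x ^ μ), mul_assoc]
      gcongr
    · intro w hw
      rw [frontier_ball _ hr0, mem_sphere_zero_iff_norm] at hw
      have hwc : w ∈ Metric.closedBall (0 : ℂ) x⁻¹ := mem_closedBall_zero_iff.mpr hw.le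
      have h1 := norm_X_mul_derivative_le hk hdeg hf (hin w hwc)
      rw [hge, norm_mul, norm_pow, hw, inv_pow, inv_mul_le_iff₀ (pow_pos hx0 μ)] at h1
      rwa [norm_div, div_le_iff₀ (norm_pos_iff.mpr (hB w hwc))]
  have hcont : Filter.Tendsto (fun x : ℝ ↦ (x * ‖z‖) ^ μ * ‖(coderivative n f).eval z‖)
      (nhdsWithin k (Set.Ioi k)) (nhds ((k * ‖z‖) ^ μ * ‖(coderivative n f).eval z‖)) :=
    Continuous.continuousWithinAt (by fun_prop)
  refine ge_of_tendsto hcont ?_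
  have hev : ∀ᶠ x in nhdsWithin k (Set.Ioi k), x * ‖z‖ < 1 :=
    (Continuous.continuousWithinAt (f := fun x : ℝ ↦ x * ‖z‖) (by fun_prop)).eventually
      (gt_mem_nhds hz)
  filter_upwards [hev, self_mem_nhdsWithin] with x h1 h2 using step x h2 h1

/-- Maximum principle for `1/f`. -/
theorem le_norm_eval_of_le_on_sphere {M : ℝ} (hk : 0 < k)
    (hf : ∀ z : ℂ, k * ‖z‖ < 1 → f.eval z ≠ 0) (hM : ∀ z : ℂ, k * ‖z‖ = 1 → M ≤ ‖f.eval z‖)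
    (hz : k * ‖z‖ < 1) : M ≤ ‖f.eval z‖ := by
  rcases le_or_gt M 0 with h0 | h0
  · exact h0.trans (norm_nonneg _)
  have hr0 : k⁻¹ ≠ 0 := (inv_pos.mpr hk).ne'
  have hle : ∀ w : ℂ, ‖w‖ ≤ k⁻¹ ↔ k * ‖w‖ ≤ 1 := fun w ↦ by
    rw [← one_div, le_div_iff₀ hk, mul_comm]
  have hne : ∀ w ∈ Metric.closedBall (0 : ℂ) k⁻¹, f.eval w ≠ 0 := by
    intro w hw
    rw [mem_closedBall_zero_iff, hle] at hw
    rcases hw.lt_or_eq with h | h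
    · exact hf w h
    · exact norm_pos_iff.mp (h0.trans_le (hM w h))
  have hd : DiffContOnCl ℂ (fun w ↦ (f.eval w)⁻¹) (Metric.ball 0 k⁻¹) := by
    refine DifferentiableOn.diffContOnCl ?_
    rw [closure_ball _ hr0]
    exact f.differentiable.differentiableOn.fun_inv hne
  have hmax := Complex.norm_le_of_forall_mem_frontier_norm_le Metric.isBounded_ball hd
    (C := M⁻¹) (z := z) ?_ (by
      rw [closure_ball _ hr0, mem_closedBall_zero_iff, hle]; exact hz.le)
  · rw [norm_inv] at hmax
    exact (inv_le_inv₀ (norm_pos_iff.mpr (hf z hz)) h0).mp hmax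
  · intro w hw
    rw [frontier_ball _ hr0, mem_sphere_zero_iff_norm] at hw
    rw [norm_inv]
    refine inv_anti₀ h0 (hM w ?_)
    rw [hw, mul_inv_cancel₀ hk.ne']

/-- For `|e| = t < M`, `f - e` is still zero-free with the same derivative, and its coderivative at
`z` is `b - n e`. Giving `e` the argument of `b` makes `|b - n e| = |‖b‖ - n t|`; then `t → M`. -/
theorem norm_X_mul_derivative_add_le {μ : ℕ} {M : ℝ} (hk : 0 ≤ k) (hn : 0 < n)
    (hdeg : f.natDegree ≤ n)
    (hf : ∀ z : ℂ, k * ‖z‖ < 1 → f.eval z ≠ 0) (hM0 : 0 ≤ M)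
    (hM : ∀ z : ℂ, k * ‖z‖ < 1 → M ≤ ‖f.eval z‖) (hμ : X ^ μ ∣ X * derivative f)
    (hz : k * ‖z‖ < 1) :
    ‖z * f.derivative.eval z‖ + (k * ‖z‖) ^ μ * (n * M)
      ≤ (k * ‖z‖) ^ μ * ‖(coderivative n f).eval z‖ := by
  set b := (coderivative n f).eval z with hb
  have hn' : (0 : ℝ) < n := by exact_mod_cast hn
  have hb0 : b ≠ 0 := coderivative_eval_ne_zero hk hn hdeg hf hz
  have hbpos : 0 < ‖b‖ := norm_pos_iff.mpr hb0
  -- perturbing `f` by a constant of modulus less than `M` keeps it free of zeros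
  have pert : ∀ t : ℝ, 0 ≤ t → t < M →
      b - n * (t * (b / ‖b‖)) ≠ 0 ∧
      ‖z * f.derivative.eval z‖ ≤ (k * ‖z‖) ^ μ * ‖b - n * (t * (b / ‖b‖))‖ := by
    intro t ht0 ht
    set e : ℂ := t * (b / ‖b‖) with he
    have hnorm : ‖e‖ = t := by
      rw [he, norm_mul, norm_div, Complex.norm_real, Complex.norm_real, norm_norm,
        div_self hbpos.ne', mul_one, Real.norm_of_nonneg ht0]
    have hdeg' : (f - C e).natDegree ≤ n := by
      rw [natDegree_sub_C]; exact hdeg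
    have hf' : ∀ w : ℂ, k * ‖w‖ < 1 → (f - C e).eval w ≠ 0 := by
      intro w hw h0
      rw [eval_sub, eval_C, sub_eq_zero] at h0
      have := hM w hw
      rw [h0, hnorm] at this
      linarith
    have hder : derivative (f - C e) = derivative f := by simp
    have hco : (coderivative n (f - C e)).eval z = b - n * e := by
      rw [hb, eval_coderivative, eval_coderivative, hder, eval_sub, eval_C]
      ring
    have h1 := coderivative_eval_ne_zero hk hn hdeg' hf' hz
    have h2 := norm_X_mul_derivative_le_pow hk hn hdeg' hf' (by rwa [hder]) hz
    rw [hco] at h1 h2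
    rw [hder] at h2
    exact ⟨h1, h2⟩
  have hfac : ∀ t : ℝ, b - n * (t * (b / ‖b‖)) = ((‖b‖ - n * t : ℝ) : ℂ) * (b / ‖b‖) := by
    intro t
    have : (‖b‖ : ℂ) ≠ 0 := by exact_mod_cast hbpos.ne'
    push_cast
    field_simp
  have hfacn : ∀ t : ℝ, ‖b - n * (t * (b / ‖b‖))‖ = |‖b‖ - n * t| := by
    intro t
    rw [hfac, norm_mul, norm_div, Complex.norm_real, Complex.norm_real, norm_norm,
        div_self hbpos.ne', mul_one, Real.norm_eq_abs]
  -- Otherwise `t = ‖b‖ / n` is admissible and makes the perturbed coderivative vanish.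
  have hbM : n * M ≤ ‖b‖ := by
    by_contra! hlt
    refine (pert (‖b‖ / n) (by positivity) (by rwa [div_lt_iff₀ hn', mul_comm])).1 ?_
    rw [← norm_eq_zero, hfacn, mul_div_cancel₀ _ hn'.ne', sub_self, abs_zero]
  rcases hM0.eq_or_lt with rfl | hMpos
  · simpa using norm_X_mul_derivative_le_pow hk hn hdeg hf hμ hz
  have hcont : Filter.Tendsto (fun t : ℝ ↦ (k * ‖z‖) ^ μ * (‖b‖ - n * t))
      (nhdsWithin M (Set.Iio M)) (nhds ((k * ‖z‖) ^ μ * (‖b‖ - n * M))) :=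
    Continuous.continuousWithinAt (by fun_prop)
  have hlim : ‖z * f.derivative.eval z‖ ≤ (k * ‖z‖) ^ μ * (‖b‖ - n * M) := by
    refine ge_of_tendsto hcont ?_
    filter_upwards [Ioo_mem_nhdsLT hMpos] with t ht
    have h := (pert t ht.1.le ht.2).2
    rwa [hfacn, abs_of_nonneg] at h
    have : (n : ℝ) * t ≤ n * M := by gcongr; exact ht.2.le
    linarith
  linarith

end ZeroFree

/-! ### Littlewood subordination through the Poisson kernel. -/

open MeasureTheory in
theorem intervalIntegral_swap_of_continuous {F : ℝ → ℝ → ℝ} (hF : Continuous F.uncurry)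
    {a b : ℝ} (hab : a ≤ b) :
    ∫ x in a..b, ∫ y in a..b, F x y = ∫ y in a..b, ∫ x in a..b, F x y := by
  simp only [intervalIntegral.integral_of_le hab]
  refine integral_integral_swap ?_
  rw [Measure.prod_restrict]
  exact (hF.continuousOn.integrableOn_compact (isCompact_Icc.prod isCompact_Icc)).mono_set
    (Set.prod_mono Set.Ioc_subset_Icc_self Set.Ioc_subset_Icc_self)

theorem norm_circleMap_zero' {R : ℝ} (hR : 0 ≤ R) (θ : ℝ) : ‖circleMap 0 R θ‖ = R := by
  rw [norm_circleMap_zero, abs_of_nonneg hR]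

/-- The mean of the Poisson kernel along a holomorphic function vanishing at the centre. -/
theorem integral_poissonKernel_comp {W : ℂ → ℂ} {R : ℝ}
    (hW : DiffContOnCl ℂ W (Metric.ball 0 1)) (hW0 : W 0 = 0)
    (hWR : ∀ z ∈ Metric.closedBall (0 : ℂ) 1, ‖W z‖ < R) {ξ : ℂ} (hξ : ‖ξ‖ = R) :
    ∫ θ in (0 : ℝ)..(2 * Real.pi), poissonKernel 0 (W (circleMap 0 1 θ)) ξ = 2 * Real.pi := by
  have hne : ∀ z ∈ Metric.closedBall (0 : ℂ) 1, ξ - W z ≠ 0 := by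
    intro z hz h0
    have := hWR z hz
    rw [← sub_eq_zero.mp h0, hξ] at this
    exact lt_irrefl _ this
  have hξ0 : ξ ≠ 0 := by simpa [hW0] using hne 0 (by simp)
  have hcl : closure (Metric.ball (0 : ℂ) 1) = Metric.closedBall 0 1 := closure_ball _ one_ne_zero
  -- The kernel is the real part of this function, which equals `1` at the centre; the mean value
  -- property applies.
  have hG : DiffContOnCl ℂ (fun z ↦ (ξ + W z) / (ξ - W z)) (Metric.ball 0 1) := by
    refine ⟨(hW.differentiableOn.const_add ξ).fun_div (hW.differentiableOn.const_sub ξ)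
      fun z hz ↦ hne z (Metric.ball_subset_closedBall hz), ?_⟩
    have hc := hW.continuousOn
    rw [hcl] at hc ⊢
    exact (continuousOn_const.add hc).div (continuousOn_const.sub hc) hne
  have hmean := DiffContOnCl.circleAverage (R := 1) (c := 0) (by rwa [abs_one])
  simp only [hW0, add_zero, sub_zero, div_self hξ0] at hmean
  rw [Real.circleAverage_def] at hmean
  have hcirc : ∀ θ : ℝ, circleMap 0 1 θ ∈ Metric.closedBall (0 : ℂ) 1 := fun θ ↦
    circleMap_mem_closedBall 0 zero_le_one θ
  have hcont : Continuous fun θ : ℝ ↦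
      (ξ + W (circleMap 0 1 θ)) / (ξ - W (circleMap 0 1 θ)) := by
    have hc := hG.continuousOn
    rw [hcl] at hc
    exact hc.comp_continuous (continuous_circleMap 0 1) hcirc
  have hre := Complex.reCLM.intervalIntegral_comp_comm
    (hcont.intervalIntegrable (μ := MeasureTheory.volume) 0 (2 * Real.pi))
  have hint : ∫ θ in (0 : ℝ)..(2 * Real.pi),
      (ξ + W (circleMap 0 1 θ)) / (ξ - W (circleMap 0 1 θ)) = (2 * Real.pi : ℝ) := by
    have hpi : (2 * Real.pi : ℝ) ≠ 0 := by positivity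
    rw [inv_smul_eq_iff₀ hpi] at hmean
    rw [hmean, Complex.real_smul, mul_one]
  rw [hint] at hre
  simp only [Complex.reCLM_apply, Complex.ofReal_re] at hre
  rw [← hre]
  congr 1
  ext θ
  rw [poissonKernel_eq_re_herglotzRieszKernel]
  simp [herglotzRieszKernel_def]

/-- Littlewood's subordination principle for the mean of `|h|`. -/
theorem integral_norm_comp_le_of_subordinate {W h : ℂ → ℂ} {R : ℝ}
    (hW : DiffContOnCl ℂ W (Metric.ball 0 1)) (hW0 : W 0 = 0)
    (hWR : ∀ z ∈ Metric.closedBall (0 : ℂ) 1, ‖W z‖ < R)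
    (hh : DiffContOnCl ℂ h (Metric.ball 0 R)) :
    ∫ θ in (0 : ℝ)..(2 * Real.pi), ‖h (W (circleMap 0 1 θ))‖
      ≤ ∫ θ in (0 : ℝ)..(2 * Real.pi), ‖h (circleMap 0 R θ)‖ := by
  have hR : 0 < R := by simpa [hW0] using hWR 0 (by simp)
  have hpi : (0 : ℝ) < 2 * Real.pi := by positivity
  have hcirc : ∀ θ : ℝ, circleMap 0 1 θ ∈ Metric.closedBall (0 : ℂ) 1 := fun θ ↦
    circleMap_mem_closedBall 0 zero_le_one θ
  have hWc : Continuous fun θ : ℝ ↦ W (circleMap 0 1 θ) := by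
    have hc := hW.continuousOn
    rw [closure_ball _ one_ne_zero] at hc
    exact hc.comp_continuous (continuous_circleMap 0 1) hcirc
  have hhc := hh.continuousOn
  rw [closure_ball _ hR.ne'] at hhc
  have hhR : Continuous fun t : ℝ ↦ h (circleMap 0 R t) :=
    hhc.comp_continuous (continuous_circleMap 0 R) fun t ↦ circleMap_mem_closedBall 0 hR.le t
  have hhW : Continuous fun θ : ℝ ↦ h (W (circleMap 0 1 θ)) :=
    hhc.comp_continuous hWc fun θ ↦ mem_closedBall_zero_iff.mpr (hWR _ (hcirc θ)).le
  have hne : ∀ θ t : ℝ, circleMap 0 R t - W (circleMap 0 1 θ) ≠ 0 := by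
    intro θ t h0
    have := hWR _ (hcirc θ)
    rw [← sub_eq_zero.mp h0, norm_circleMap_zero' hR.le] at this
    exact lt_irrefl _ this
  have hK : Continuous (fun q : ℝ × ℝ ↦
      poissonKernel 0 (W (circleMap 0 1 q.1)) (circleMap 0 R q.2)) := by
    simp only [poissonKernel_def, sub_zero]
    have h1 : Continuous fun q : ℝ × ℝ ↦ W (circleMap 0 1 q.1) := hWc.comp continuous_fst
    have h2 : Continuous fun q : ℝ × ℝ ↦ circleMap 0 R q.2 :=
      (continuous_circleMap 0 R).comp continuous_snd
    refine ((h2.norm.pow 2).sub (h1.norm.pow 2)).div ((h2.sub h1).norm.pow 2) fun q ↦ ?_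
    exact pow_ne_zero _ (norm_ne_zero_iff.mpr (hne q.1 q.2))
  have hKpos : ∀ θ t : ℝ, 0 ≤ poissonKernel 0 (W (circleMap 0 1 θ)) (circleMap 0 R t) := by
    intro θ t
    rw [poissonKernel_def, sub_zero, sub_zero, norm_circleMap_zero' hR.le]
    have := pow_le_pow_left₀ (norm_nonneg _) (hWR _ (hcirc θ)).le 2
    have : 0 ≤ R ^ 2 - ‖W (circleMap 0 1 θ)‖ ^ 2 := by linarith
    positivity
  set K : ℝ → ℝ → ℝ := fun θ t ↦
    poissonKernel 0 (W (circleMap 0 1 θ)) (circleMap 0 R t) * ‖h (circleMap 0 R t)‖ with hKdef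
  have hKc : Continuous K.uncurry := hK.mul (hhR.norm.comp continuous_snd)
  -- Poisson's formula for `h` at the interior point `W`; integrating over `θ` and swapping leaves
  -- the kernel mean just computed.
  have hpoint : ∀ θ : ℝ, ‖h (W (circleMap 0 1 θ))‖
      ≤ (2 * Real.pi)⁻¹ * ∫ t in (0 : ℝ)..(2 * Real.pi), K θ t := by
    intro θ
    have hp := hh.circleAverage_poissonKernel_smul (mem_ball_zero_iff.mpr (hWR _ (hcirc θ)))
    rw [Real.circleAverage_def] at hp
    rw [← hp, norm_smul, Real.norm_of_nonneg (by positivity)]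
    gcongr
    refine (intervalIntegral.norm_integral_le_integral_norm hpi.le).trans_eq ?_
    congr 1
    ext t
    rw [Pi.smul_apply', norm_smul, Real.norm_of_nonneg (hKpos θ t)]
  calc ∫ θ in (0 : ℝ)..(2 * Real.pi), ‖h (W (circleMap 0 1 θ))‖
      ≤ ∫ θ in (0 : ℝ)..(2 * Real.pi),
          (2 * Real.pi)⁻¹ * ∫ t in (0 : ℝ)..(2 * Real.pi), K θ t := by
        refine intervalIntegral.integral_mono_on hpi.le (hhW.norm.intervalIntegrable _ _)
          (Continuous.intervalIntegrable ?_ _ _) fun θ _ ↦ hpoint θ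
        exact continuous_const.mul
          (intervalIntegral.continuous_parametric_intervalIntegral_of_continuous' hKc _ _)
    _ = (2 * Real.pi)⁻¹ * ∫ t in (0 : ℝ)..(2 * Real.pi), ∫ θ in (0 : ℝ)..(2 * Real.pi), K θ t := by
        rw [intervalIntegral.integral_const_mul, intervalIntegral_swap_of_continuous hKc hpi.le]
    _ = (2 * Real.pi)⁻¹ * ∫ t in (0 : ℝ)..(2 * Real.pi),
          2 * Real.pi * ‖h (circleMap 0 R t)‖ := by
        congr 2
        ext t
        rw [hKdef, intervalIntegral.integral_mul_const,
          integral_poissonKernel_comp hW hW0 hWR (norm_circleMap_zero' hR.le t)]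
    _ = _ := by
        rw [intervalIntegral.integral_const_mul, ← mul_assoc, inv_mul_cancel₀ hpi.ne', one_mul]

/-- `R ≤ 1` keeps `1 + z` in the right half-plane; at `z = -1`, reached when `R = 1`, continuity
needs `p > 0`. -/
theorem diffContOnCl_one_add_cpow {R p : ℝ} (hR0 : 0 < R) (hR1 : R ≤ 1) (hp : 0 < p) :
    DiffContOnCl ℂ (fun z : ℂ ↦ (1 + z) ^ (p : ℂ)) (Metric.ball 0 R) := by
  have hre : ∀ z : ℂ, -‖z‖ ≤ z.re := fun z ↦ (abs_le.mp (Complex.abs_re_le_norm z)).1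
  constructor
  · intro z hz
    rw [mem_ball_zero_iff] at hz
    have hs : 1 + z ∈ Complex.slitPlane := by
      refine Or.inl ?_
      rw [Complex.add_re, Complex.one_re]
      linarith [hre z]
    exact ((differentiableAt_id.const_add 1).cpow_const hs).differentiableWithinAt
  · rw [closure_ball _ hR0.ne']
    intro z hz
    rw [mem_closedBall_zero_iff] at hz
    have h1 : 0 ≤ ((1 + z, (p : ℂ)) : ℂ × ℂ).1.re := by
      simp only [Complex.add_re, Complex.one_re]
      linarith [hre z]
    have h2 := Complex.continuousAt_cpow_of_re_pos (p := (1 + z, (p : ℂ))) (Or.inl h1)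
      (by simpa using hp)
    have h3 : ContinuousAt (fun w : ℂ ↦ ((1 + w, (p : ℂ)) : ℂ × ℂ)) z := by fun_prop
    exact (ContinuousAt.comp (f := fun w : ℂ ↦ ((1 + w, (p : ℂ)) : ℂ × ℂ)) h2 h3).continuousWithinAt

/-! ### Subordination on the unit circle for polynomial quotients. -/

theorem unitPoint_eq_circleMap (θ : ℝ) : unitPoint θ = circleMap 0 1 θ := by
  simp [unitPoint, circleMap]

theorem norm_unitPoint (θ : ℝ) : ‖unitPoint θ‖ = 1 := Complex.norm_exp_ofReal_mul_I θ

theorem continuous_unitPoint : Continuous unitPoint := by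
  unfold unitPoint
  fun_prop

theorem ae_eval_unitPoint_ne_zero {B : ℂ[X]} (hB : B ≠ 0) :
    ∀ᵐ θ : ℝ, B.eval (unitPoint θ) ≠ 0 := by
  have hfib : ∀ w : ℂ, {θ : ℝ | unitPoint θ = w}.Countable := by
    intro w
    rcases Set.eq_empty_or_nonempty {θ : ℝ | unitPoint θ = w} with h | ⟨θ₀, h₀⟩
    · simp [h]
    refine (Set.countable_range fun j : ℤ ↦ θ₀ + j * (2 * Real.pi)).mono fun θ hθ ↦ ?_
    have heq : unitPoint θ = unitPoint θ₀ := Eq.trans hθ (Eq.symm h₀)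
    obtain ⟨j, hj⟩ := Complex.exp_eq_exp_iff_exists_int.mp heq
    refine ⟨j, ?_⟩
    have him := congrArg Complex.im hj
    simp at him
    simp [him]
  have hset : {θ : ℝ | B.eval (unitPoint θ) = 0}
      = ⋃ w ∈ B.roots.toFinset, {θ : ℝ | unitPoint θ = w} := by
    ext θ
    simp [hB]
  have hcount : {θ : ℝ | B.eval (unitPoint θ) = 0}.Countable := by
    rw [hset]
    exact B.roots.toFinset.countable_toSet.biUnion fun w _ ↦ hfib w
  exact hcount.ae_notMem MeasureTheory.volume

/-- Subordination for quotients of polynomials whose denominator may vanish on the circle. -/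
theorem integral_norm_one_add_div_rpow_le {A B : ℂ[X]} {c p : ℝ} (hc0 : 0 ≤ c) (hc1 : c ≤ 1)
    (hp : 0 < p) (hB : ∀ z : ℂ, ‖z‖ < 1 → B.eval z ≠ 0)
    (hAB : ∀ z : ℂ, ‖z‖ < 1 → ‖A.eval z‖ ≤ c * ‖z‖ * ‖B.eval z‖) :
    ∫ θ in (0 : ℝ)..(2 * Real.pi), ‖1 + A.eval (unitPoint θ) / B.eval (unitPoint θ)‖ ^ p
      ≤ ∫ θ in (0 : ℝ)..(2 * Real.pi), ‖1 + c * unitPoint θ‖ ^ p := by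
  have hquot : ∀ z : ℂ, ‖z‖ < 1 → ‖A.eval z / B.eval z‖ ≤ c * ‖z‖ := by
    intro z hz
    rw [norm_div, div_le_iff₀ (norm_pos_iff.mpr (hB z hz))]
    exact hAB z hz
  have hrn : ∀ r ∈ Set.Ioo (0 : ℝ) 1, ∀ z ∈ Metric.closedBall (0 : ℂ) 1, ‖(r : ℂ) * z‖ ≤ r := by
    intro r hr z hz
    rw [mem_closedBall_zero_iff] at hz
    rw [norm_mul, Complex.norm_real, Real.norm_of_nonneg hr.1.le]
    exact mul_le_of_le_one_right hr.1.le hz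
  have hu : ∀ θ : ℝ, unitPoint θ ∈ Metric.closedBall (0 : ℂ) 1 := fun θ ↦
    mem_closedBall_zero_iff.mpr (norm_unitPoint θ).le
  -- On circles of radius `r < 1` the denominator has no zero and subordination applies directly;
  -- dominated convergence then lets `r → 1`.
  have hrad : ∀ r ∈ Set.Ioo (0 : ℝ) 1,
      ∫ θ in (0 : ℝ)..(2 * Real.pi),
        ‖1 + A.eval (r * unitPoint θ) / B.eval (r * unitPoint θ)‖ ^ p
      ≤ ∫ θ in (0 : ℝ)..(2 * Real.pi), ‖1 + c * unitPoint θ‖ ^ p := by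
    intro r hr
    rcases hc0.eq_or_lt with rfl | hcpos
    · refine le_of_eq ?_
      congr 1
      ext θ
      have := hquot _ ((hrn r hr _ (hu θ)).trans_lt hr.2)
      rw [zero_mul, norm_le_zero_iff] at this
      rw [this]
      simp
    have hBr : ∀ z ∈ Metric.closedBall (0 : ℂ) 1, B.eval (r * z) ≠ 0 := fun z hz ↦
      hB _ ((hrn r hr z hz).trans_lt hr.2)
    have hW : DiffContOnCl ℂ (fun z : ℂ ↦ A.eval (r * z) / B.eval (r * z)) (Metric.ball 0 1) := by
      refine DifferentiableOn.diffContOnCl ?_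
      rw [closure_ball _ one_ne_zero]
      refine DifferentiableOn.fun_div ?_ ?_ hBr
      · exact (A.differentiable.comp (differentiable_id.const_mul (r : ℂ))).differentiableOn
      · exact (B.differentiable.comp (differentiable_id.const_mul (r : ℂ))).differentiableOn
    have hW0 : A.eval ((r : ℂ) * 0) / B.eval ((r : ℂ) * 0) = 0 := by
      have := hquot 0 (by simp)
      rw [norm_zero, mul_zero, norm_le_zero_iff] at this
      rw [mul_zero, this]
    have hWR : ∀ z ∈ Metric.closedBall (0 : ℂ) 1, ‖A.eval (r * z) / B.eval (r * z)‖ < c := by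
      intro z hz
      have h1 := hrn r hr z hz
      calc _ ≤ c * ‖(r : ℂ) * z‖ := hquot _ (h1.trans_lt hr.2)
        _ ≤ c * r := by gcongr
        _ < c := mul_lt_of_lt_one_right hcpos hr.2
    have hmain := integral_norm_comp_le_of_subordinate hW hW0 hWR
      (diffContOnCl_one_add_cpow hcpos hc1 hp)
    have hnorm : ∀ w : ℂ, ‖(1 + w) ^ (p : ℂ)‖ = ‖1 + w‖ ^ p := fun w ↦
      Complex.norm_cpow_real _ _
    have hc : ∀ θ : ℝ, circleMap 0 c θ = c * circleMap 0 1 θ := fun θ ↦ by simp [circleMap]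
    simp only [hnorm, hc, ← unitPoint_eq_circleMap] at hmain
    exact hmain
  have hB0 : B ≠ 0 := by
    rintro rfl
    exact hB 0 (by simp) (by simp)
  have hcont : ∀ r ∈ Set.Ioo (0 : ℝ) 1, Continuous fun θ : ℝ ↦
      ‖1 + A.eval (r * unitPoint θ) / B.eval (r * unitPoint θ)‖ ^ p := by
    intro r hr
    have h1 : Continuous fun θ : ℝ ↦ (r : ℂ) * unitPoint θ :=
      continuous_const.mul continuous_unitPoint
    have h2 : Continuous fun θ : ℝ ↦
        1 + A.eval (r * unitPoint θ) / B.eval (r * unitPoint θ) :=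
      continuous_const.add ((A.continuous.comp h1).div (B.continuous.comp h1) fun θ ↦
        hB _ ((hrn r hr _ (hu θ)).trans_lt hr.2))
    exact h2.norm.rpow_const fun θ ↦ Or.inr hp.le
  have hnear : ∀ᶠ r in nhdsWithin (1 : ℝ) (Set.Iio 1), r ∈ Set.Ioo (0 : ℝ) 1 :=
    Ioo_mem_nhdsLT zero_lt_one
  refine le_of_tendsto (f := fun r : ℝ ↦ ∫ θ in (0 : ℝ)..(2 * Real.pi),
      ‖1 + A.eval (r * unitPoint θ) / B.eval (r * unitPoint θ)‖ ^ p)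
    (x := nhdsWithin (1 : ℝ) (Set.Iio 1)) ?_ (hnear.mono hrad)
  refine intervalIntegral.tendsto_integral_filter_of_dominated_convergence (fun _ ↦ 2 ^ p)
    ?_ ?_ intervalIntegrable_const ?_
  · exact hnear.mono fun r hr ↦ (hcont r hr).aestronglyMeasurable
  · refine hnear.mono fun r hr ↦ Filter.Eventually.of_forall fun θ _ ↦ ?_
    rw [Real.norm_of_nonneg (by positivity)]
    have h1 := hrn r hr _ (hu θ)
    have h2 : ‖A.eval (r * unitPoint θ) / B.eval (r * unitPoint θ)‖ ≤ 1 :=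
      (hquot _ (h1.trans_lt hr.2)).trans
        (mul_le_one₀ hc1 (norm_nonneg _) (h1.trans hr.2.le))
    refine Real.rpow_le_rpow (norm_nonneg _) ?_ hp.le
    refine (norm_add_le _ _).trans ?_
    rw [norm_one]
    linarith
  -- Pointwise convergence may fail only at the zeros of `B` on the circle, a null set of angles.
  · filter_upwards [ae_eval_unitPoint_ne_zero hB0] with θ hθ _
    have h1 : ContinuousAt (fun r : ℝ ↦ (r : ℂ) * unitPoint θ) 1 := by fun_prop
    have h2 : ContinuousAt (fun z : ℂ ↦ ‖1 + A.eval z / B.eval z‖ ^ p)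
        (((1 : ℝ) : ℂ) * unitPoint θ) := by
      rw [Complex.ofReal_one, one_mul]
      exact ((continuousAt_const.add (A.continuous.continuousAt.div B.continuous.continuousAt
        hθ)).norm).rpow_const (Or.inr hp.le)
    have h3 := (ContinuousAt.comp (f := fun r : ℝ ↦ (r : ℂ) * unitPoint θ) h2 h1).continuousWithinAt
      (s := Set.Iio 1)
    simpa [ContinuousWithinAt, Function.comp_def] using h3

/-! ### The reversed polynomial. -/

section Reflect

variable {P : ℂ[X]} {n : ℕ}

theorem eval_eq_pow_mul_eval_reflect (hdeg : P.natDegree ≤ n) {z : ℂ} (hz : z ≠ 0) :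
    P.eval z = z ^ n * (P.reflect n).eval z⁻¹ := by
  let _ := invertibleOfNonzero hz
  have h := eval₂_reflect_mul_pow (RingHom.id ℂ) z n P hdeg
  rw [invOf_eq_inv] at h
  rw [mul_comm]
  exact h.symm

/-- Differentiate `P(z) = z^n f(1/z)`. -/
theorem mul_eval_derivative_eq (hdeg : P.natDegree ≤ n) {z : ℂ} (hz : z ≠ 0) :
    z * (derivative P).eval z = z ^ n * (coderivative n (P.reflect n)).eval z⁻¹ := by
  set f := P.reflect n with hf
  have h1 : HasDerivAt (fun w : ℂ ↦ w ^ n * f.eval w⁻¹)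
      (n * z ^ (n - 1) * f.eval z⁻¹ + z ^ n * ((derivative f).eval z⁻¹ * -(z ^ 2)⁻¹)) z :=
    (hasDerivAt_pow n z).mul ((f.hasDerivAt z⁻¹).comp z (hasDerivAt_inv hz))
  have h2 : HasDerivAt (fun w : ℂ ↦ w ^ n * f.eval w⁻¹) ((derivative P).eval z) z := by
    refine (P.hasDerivAt z).congr_of_eventuallyEq ?_
    filter_upwards [isOpen_ne.mem_nhds hz] with w hw
    exact (eval_eq_pow_mul_eval_reflect hdeg hw).symm
  have hpow : (n : ℂ) * z ^ (n - 1) * z = n * z ^ n := by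
    rcases n.eq_zero_or_pos with h0 | h0
    · simp [h0]
    · rw [mul_assoc, pow_sub_one_mul h0.ne']
  rw [h2.unique h1, eval_coderivative]
  calc z * (n * z ^ (n - 1) * f.eval z⁻¹ + z ^ n * ((derivative f).eval z⁻¹ * -(z ^ 2)⁻¹))
      = (n * z ^ (n - 1) * z) * f.eval z⁻¹
          - z ^ n * ((z * (z ^ 2)⁻¹) * (derivative f).eval z⁻¹) := by ring
    _ = _ := by
      have : z * (z ^ 2)⁻¹ = z⁻¹ := by field_simp
      rw [hpow, this]
      ring

theorem eval_reflect_ne_zero {k : ℝ} (hP : P ≠ 0) (hdeg : P.natDegree = n)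
    (hroots : ∀ z : ℂ, P.IsRoot z → ‖z‖ ≤ k) {z : ℂ} (hz : k * ‖z‖ < 1) :
    (P.reflect n).eval z ≠ 0 := by
  intro h0
  rcases eq_or_ne z 0 with rfl | hz0
  · rw [← coeff_zero_eq_eval_zero, coeff_reflect, revAt_le n.zero_le, Nat.sub_zero, ← hdeg,
      coeff_natDegree, leadingCoeff_eq_zero] at h0
    exact hP h0
  · have hroot : P.IsRoot z⁻¹ := by
      rw [IsRoot.def, eval_eq_pow_mul_eval_reflect hdeg.le (inv_ne_zero hz0), inv_inv, h0, mul_zero]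
    have h1 := hroots _ hroot
    rw [norm_inv, ← one_div, div_le_iff₀ (norm_pos_iff.mpr hz0)] at h1
    linarith

theorem X_pow_dvd_X_mul_derivative_reflect {μ : ℕ} (hμn : μ ≤ n)
    (hcoeff : ∀ d, 0 < d → d < μ → P.coeff (n - d) = 0) :
    X ^ μ ∣ X * derivative (P.reflect n) := by
  rw [X_pow_dvd_iff]
  intro d hd
  rcases d with _ | e
  · simp
  · rw [coeff_X_mul, coeff_derivative, coeff_reflect, revAt_le (by omega),
      hcoeff _ e.succ_pos hd, zero_mul]

/-- The minimum modulus on the circle `|z| = k` bounds the reversed polynomial from below. -/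
theorem exists_le_norm_eval_reflect {μ : ℕ} {k m : ℝ} (hn : 0 < n) (hμn : μ ≤ n)
    (hdeg : P.natDegree = n) (hk0 : 0 ≤ k) (hroots : ∀ z : ℂ, P.IsRoot z → ‖z‖ ≤ k)
    (hm : IsLeast ((fun z : ℂ => ‖P.eval z‖) '' Metric.sphere (0 : ℂ) k) m) :
    ∃ M : ℝ, 0 ≤ M ∧ m / k ^ (n - μ) = k ^ μ * M ∧
      ∀ z : ℂ, k * ‖z‖ < 1 → M ≤ ‖(P.reflect n).eval z‖ := by
  have hP : P ≠ 0 := by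
    rintro rfl
    simp at hdeg
    omega
  have hm0 : 0 ≤ m := by
    obtain ⟨z, -, rfl⟩ := hm.1
    exact norm_nonneg _
  rcases hk0.eq_or_lt with rfl | hk
  -- For `k = 0` the only root is `0`, so `m = 0` and `M = 0` works.
  · have hm' : m = 0 := by
      obtain ⟨r, hr⟩ := IsAlgClosed.exists_root P
        (by rw [degree_eq_natDegree hP, hdeg]; exact_mod_cast hn.ne')
      have hr0 : r = 0 := norm_le_zero_iff.mp (hroots r hr)
      refine le_antisymm (hm.2 ⟨0, by simp, ?_⟩) hm0
      rw [← hr0]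
      simpa using hr
    exact ⟨0, le_rfl, by simp [hm'], fun z _ ↦ norm_nonneg _⟩
  -- For `|w| = 1/k`, `|P(1/w)| = k^n |f(w)|`, whence this `M`.
  refine ⟨m / k ^ n, by positivity, ?_, fun z hz ↦ ?_⟩
  · rw [← Nat.sub_add_cancel hμn, pow_add, Nat.add_sub_cancel]
    field_simp
  · refine le_norm_eval_of_le_on_sphere hk (fun w hw ↦ eval_reflect_ne_zero hP hdeg hroots hw)
      (fun w hw ↦ ?_) hz
    have hwn : ‖w‖ = k⁻¹ := eq_inv_of_mul_eq_one_right hw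
    have hw0 : w ≠ 0 := by
      rintro rfl
      simp at hw
    have h1 : m ≤ ‖P.eval w⁻¹‖ := hm.2 ⟨w⁻¹, by simp [hwn], rfl⟩
    rw [eval_eq_pow_mul_eval_reflect hdeg.le (inv_ne_zero hw0), inv_inv, norm_mul, norm_pow,
      norm_inv, hwn, inv_inv] at h1
    rwa [div_le_iff₀ (pow_pos hk n), mul_comm]

/-- Uses `n P - z P' = z^n (w f'(w))` with `w = 1/z`. -/
theorem eval_polarDerivative_eq (hdeg : P.natDegree = n) (α : ℂ) {z : ℂ} (hz : z ≠ 0) :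
    (polarDerivative α P).eval z = z ^ n * (z⁻¹ * (derivative (P.reflect n)).eval z⁻¹)
      + α * z⁻¹ * (z ^ n * (coderivative n (P.reflect n)).eval z⁻¹) := by
  have h1 := eval_eq_pow_mul_eval_reflect hdeg.le hz
  have h2 := mul_eval_derivative_eq hdeg.le hz
  have h3 : (derivative P).eval z = z⁻¹ * (z * (derivative P).eval z) := by
    rw [inv_mul_cancel_left₀ hz]
  have h4 : (polarDerivative α P).eval z
      = n * P.eval z - z * (derivative P).eval z + α * (derivative P).eval z := by
    simp only [polarDerivative, hdeg, eval_add, eval_mul, eval_sub, eval_C, eval_X]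
    ring
  rw [h4, h1, h3, mul_inv_cancel_left₀ hz, h2, eval_coderivative]
  ring

end Reflect

/-! ### The integral inequality. -/

/-- The estimate `norm_X_mul_derivative_add_le` on the closed unit disc. -/
theorem norm_X_mul_derivative_add_le_of_norm_le_one {f : ℂ[X]} {n μ : ℕ} {k M : ℝ} (hk : 0 ≤ k)
    (hk1 : k ≤ 1) (hn : 0 < n) (hdeg : f.natDegree ≤ n)
    (hf : ∀ z : ℂ, k * ‖z‖ < 1 → f.eval z ≠ 0) (hM0 : 0 ≤ M)
    (hM : ∀ z : ℂ, k * ‖z‖ < 1 → M ≤ ‖f.eval z‖) (hμ : X ^ μ ∣ X * derivative f)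
    {z : ℂ} (hz : ‖z‖ ≤ 1) :
    ‖z * f.derivative.eval z‖ + (k * ‖z‖) ^ μ * (n * M)
      ≤ (k * ‖z‖) ^ μ * ‖(coderivative n f).eval z‖ := by
  have hclosed : IsClosed {z : ℂ | ‖z * f.derivative.eval z‖ + (k * ‖z‖) ^ μ * (n * M)
      ≤ (k * ‖z‖) ^ μ * ‖(coderivative n f).eval z‖} := by
    refine isClosed_le ?_ ?_ <;> fun_prop
  -- When `k = 1` the unit circle lies outside `k|z| < 1`, so it is reached by closure.
  have hsub := closure_minimal (s := Metric.ball (0 : ℂ) 1) (fun w hw ↦ ?_) hclosed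
  · rw [closure_ball _ one_ne_zero] at hsub
    exact hsub (mem_closedBall_zero_iff.mpr hz)
  · rw [mem_ball_zero_iff] at hw
    exact norm_X_mul_derivative_add_le hk hn hdeg hf hM0 hM hμ
      ((mul_le_of_le_one_left (norm_nonneg _) hk1).trans_lt hw)

theorem theorem2 (n μ : ℕ) (hμ : 1 ≤ μ) (hμn : μ ≤ n)
    (a : ℕ → ℂ) (P : ℂ[X])
    (hP : P = C (a n) * X ^ n + ∑ j ∈ Finset.Icc μ n, C (a (n - j)) * X ^ (n - j))
    (hdeg : P.natDegree = n)
    (k : ℝ) (hk0 : 0 ≤ k) (hk1 : k ≤ 1)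
    (hroots : ∀ z : ℂ, P.IsRoot z → ‖z‖ ≤ k)
    (m : ℝ) (hm : IsLeast ((fun z : ℂ => ‖P.eval z‖) '' Metric.sphere (0 : ℂ) k) m)
    (α β : ℂ) (hα : k ^ μ ≤ ‖α‖) (hβ : ‖β‖ ≤ 1) (p : ℝ) (hp : 0 < p) :
    -- if `|α| > k ^ μ`, the quotient is defined almost everywhere and its `p`-th power integrable
    (k ^ μ < ‖α‖ →
      (∀ᵐ θ : ℝ, ‖(polarDerivative α P).eval (unitPoint θ)‖ - n * m / k ^ (n - μ) ≠ 0) ∧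
      IntervalIntegrable
        (fun θ : ℝ =>
          ‖(P.eval (unitPoint θ) + (m : ℂ) * β / (k : ℂ) ^ (n - μ)) /
            ((‖(polarDerivative α P).eval (unitPoint θ)‖ - n * m / k ^ (n - μ) : ℝ) : ℂ)‖ ^ p)
        MeasureTheory.volume 0 (2 * Real.pi)) ∧
    (n : ℝ) * (‖α‖ - k ^ μ) *
        (∫ θ in (0 : ℝ)..(2 * Real.pi),
          ‖(P.eval (unitPoint θ) + (m : ℂ) * β / (k : ℂ) ^ (n - μ)) /
            ((‖(polarDerivative α P).eval (unitPoint θ)‖ - n * m / k ^ (n - μ) : ℝ) : ℂ)‖ ^ p)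
          ^ (1 / p) ≤
      (∫ θ in (0 : ℝ)..(2 * Real.pi), ‖1 + (k : ℂ) ^ μ * unitPoint θ‖ ^ p) ^ (1 / p) := by
  have hpi : (0 : ℝ) ≤ 2 * Real.pi := by positivity
  have hn : 0 < n := by omega
  have hn' : (0 : ℝ) < n := by exact_mod_cast hn
  have hP0 : P ≠ 0 := by
    intro h
    rw [h, natDegree_zero] at hdeg
    omega
  set J := ∫ θ in (0 : ℝ)..(2 * Real.pi), ‖1 + (k : ℂ) ^ μ * unitPoint θ‖ ^ p with hJ
  have hJ0 : 0 ≤ J := intervalIntegral.integral_nonneg hpi fun θ _ ↦ by positivity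
  rcases hα.eq_or_lt with heq | hlt
  · refine ⟨fun h ↦ absurd h (by rw [heq]; exact lt_irrefl _), ?_⟩
    rw [heq, sub_self, mul_zero, zero_mul]
    exact Real.rpow_nonneg hJ0 _
  obtain ⟨M, hM0, hcM, hM⟩ := exists_le_norm_eval_reflect hn hμn hdeg hk0 hroots hm
  have hcoeff : ∀ d, 0 < d → d < μ → P.coeff (n - d) = 0 := by
    intro d hd0 hd
    rw [hP, coeff_add, coeff_C_mul_X_pow, finsetSum_coeff, if_neg (by omega), zero_add]
    refine Finset.sum_eq_zero fun j hj ↦ ?_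
    rw [Finset.mem_Icc] at hj
    rw [coeff_C_mul_X_pow, if_neg (by omega)]
  have hdvd := X_pow_dvd_X_mul_derivative_reflect hμn hcoeff
  set f := P.reflect n with hfdef
  have hfdeg : f.natDegree ≤ n := natDegree_reflect_le.trans_eq (by rw [hdeg, max_self])
  have hf : ∀ z : ℂ, k * ‖z‖ < 1 → f.eval z ≠ 0 := fun z hz ↦
    eval_reflect_ne_zero hP0 hdeg hroots hz
  set B := coderivative n f with hB
  set c := m / k ^ (n - μ) with hc
  have hkμ1 : k ^ μ ≤ 1 := pow_le_one₀ hk0 hk1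
  have hc0 : 0 ≤ c := by rw [hcM]; positivity
  have hnc : (n : ℝ) * m / k ^ (n - μ) = n * c := mul_div_assoc _ _ _
  have hβc : (m : ℂ) * β / (k : ℂ) ^ (n - μ) = c * β := by
    rw [hc]
    push_cast
    ring
  rw [hnc, hβc]
  have hdisc : ∀ z : ℂ, ‖z‖ ≤ 1 →
      ‖z * f.derivative.eval z‖ + n * c * ‖z‖ ^ μ ≤ (k * ‖z‖) ^ μ * ‖B.eval z‖ := by
    intro z hz
    have h := norm_X_mul_derivative_add_le_of_norm_le_one hk0 hk1 hn hfdeg hf hM0 hM hdvd hz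
    rw [hcM]
    refine le_trans (le_of_eq ?_) h
    ring
  set A : ℂ[X] := X * derivative f + C ((n : ℂ) * c * β) * X ^ n with hA
  have hAeval : ∀ z : ℂ, A.eval z = z * f.derivative.eval z + n * c * β * z ^ n := fun z ↦ by
    simp [hA]
  have hAB : ∀ z : ℂ, ‖z‖ ≤ 1 → ‖A.eval z‖ ≤ k ^ μ * ‖z‖ * ‖B.eval z‖ := by
    intro z hz
    have h1 : ‖(n : ℂ) * c * β * z ^ n‖ ≤ n * c * ‖z‖ ^ μ := by
      rw [norm_mul, norm_mul, norm_mul, norm_pow, Complex.norm_natCast, Complex.norm_real,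
        Real.norm_of_nonneg hc0]
      have h2 : ‖z‖ ^ n ≤ ‖z‖ ^ μ := pow_le_pow_of_le_one (norm_nonneg _) hz hμn
      calc (n : ℝ) * c * ‖β‖ * ‖z‖ ^ n ≤ n * c * 1 * ‖z‖ ^ μ := by gcongr
        _ = _ := by ring
    calc ‖A.eval z‖ ≤ ‖z * f.derivative.eval z‖ + n * c * ‖z‖ ^ μ := by
          rw [hAeval]
          exact (norm_add_le _ _).trans (by gcongr)
      _ ≤ (k * ‖z‖) ^ μ * ‖B.eval z‖ := hdisc z hz
      _ ≤ k ^ μ * ‖z‖ * ‖B.eval z‖ := by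
          rw [mul_pow]
          gcongr
          exact pow_le_of_le_one (norm_nonneg _) hz (by omega)
  have hBne : ∀ z : ℂ, ‖z‖ < 1 → B.eval z ≠ 0 := fun z hz ↦
    coderivative_eval_ne_zero hk0 hn hfdeg hf
      ((mul_le_of_le_one_left (norm_nonneg _) hk1).trans_lt hz)
  have hu0 : ∀ θ : ℝ, unitPoint θ ≠ 0 := fun θ ↦ Complex.exp_ne_zero _
  have hun : ∀ θ : ℝ, ‖(unitPoint θ)⁻¹‖ = 1 := fun θ ↦ by rw [norm_inv, norm_unitPoint, inv_one]
  -- On the circle `B(1/z)` vanishes only where `P'(z)` does.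
  have hBae : ∀ᵐ θ : ℝ, B.eval (unitPoint θ)⁻¹ ≠ 0 := by
    have hP' : derivative P ≠ 0 := fun h ↦ by
      have := derivative_eq_zero.mp h
      omega
    filter_upwards [ae_eval_unitPoint_ne_zero hP'] with θ hθ h0
    have h1 := mul_eval_derivative_eq hdeg.le (hu0 θ)
    rw [← hfdef, ← hB, h0, mul_zero] at h1
    exact (mul_ne_zero (hu0 θ) hθ) h1
  set t := ‖α‖ - k ^ μ with ht
  have ht0 : 0 < t := sub_pos.mpr hlt
  -- Subtracting `|w f'| ≤ k^μ |B| - n c` from `|α| |B|` cancels the `n c` term exactly.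
  have hden : ∀ θ : ℝ, t * ‖B.eval (unitPoint θ)⁻¹‖
      ≤ ‖(polarDerivative α P).eval (unitPoint θ)‖ - n * c := by
    intro θ
    have h1 := hdisc _ (hun θ).le
    rw [hun, one_pow, mul_one, mul_one] at h1
    have h2 : ‖α‖ * ‖B.eval (unitPoint θ)⁻¹‖
          - ‖(unitPoint θ)⁻¹ * f.derivative.eval (unitPoint θ)⁻¹‖
        ≤ ‖(polarDerivative α P).eval (unitPoint θ)‖ := by
      rw [eval_polarDerivative_eq hdeg α (hu0 θ), ← hfdef, ← hB, add_comm]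
      refine le_trans (le_of_eq ?_) (norm_sub_le_norm_add _ _)
      simp only [norm_mul, norm_pow, norm_inv, norm_unitPoint, one_pow, inv_one, one_mul, mul_one]
    rw [ht]
    linarith
  have hnum : ∀ θ : ℝ, n * ‖P.eval (unitPoint θ) + c * β‖
      = ‖A.eval (unitPoint θ)⁻¹ + B.eval (unitPoint θ)⁻¹‖ := by
    intro θ
    have h1 : (n : ℂ) * (P.eval (unitPoint θ) + c * β)
        = unitPoint θ ^ n * (A.eval (unitPoint θ)⁻¹ + B.eval (unitPoint θ)⁻¹) := by
      have h2 : unitPoint θ ^ n * (unitPoint θ)⁻¹ ^ n = 1 := by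
        rw [← mul_pow, mul_inv_cancel₀ (hu0 θ), one_pow]
      rw [eval_eq_pow_mul_eval_reflect hdeg.le (hu0 θ), hAeval, hB, eval_coderivative]
      linear_combination (-(n : ℂ) * c * β) * h2
    rw [← Complex.norm_natCast, ← norm_mul, h1, norm_mul, norm_pow, norm_unitPoint, one_pow,
      one_mul]
  set d : ℝ → ℝ := fun θ ↦ ‖(polarDerivative α P).eval (unitPoint θ)‖ - n * c with hd
  set q : ℝ → ℝ := fun θ ↦ ‖(P.eval (unitPoint θ) + c * β) / (d θ : ℂ)‖ ^ p with hq
  set g : ℂ → ℝ := fun z ↦ ‖1 + A.eval z / B.eval z‖ ^ p with hg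
  change (_ → (∀ᵐ θ : ℝ, d θ ≠ 0) ∧ IntervalIntegrable q MeasureTheory.volume 0 (2 * Real.pi)) ∧
    n * t * (∫ θ in (0 : ℝ)..(2 * Real.pi), q θ) ^ (1 / p) ≤ J ^ (1 / p)
  have hdpos : ∀ᵐ θ : ℝ, 0 < d θ := by
    filter_upwards [hBae] with θ hθ
    exact (mul_pos ht0 (norm_pos_iff.mpr hθ)).trans_le (hden θ)
  have hqg : ∀ᵐ θ : ℝ, q θ ≤ ((n * t)⁻¹) ^ p * g (unitPoint θ)⁻¹ := by
    filter_upwards [hBae, hdpos] with θ hθ hdθ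
    have hBpos : 0 < ‖B.eval (unitPoint θ)⁻¹‖ := norm_pos_iff.mpr hθ
    rw [hq, hg, ← Real.mul_rpow (by positivity) (norm_nonneg _)]
    refine Real.rpow_le_rpow (norm_nonneg _) ?_ hp.le
    have h1 : 1 + A.eval (unitPoint θ)⁻¹ / B.eval (unitPoint θ)⁻¹
        = (A.eval (unitPoint θ)⁻¹ + B.eval (unitPoint θ)⁻¹) / B.eval (unitPoint θ)⁻¹ := by
      rw [add_div, div_self hθ, add_comm]
    rw [h1, norm_div, norm_div, Complex.norm_real, Real.norm_of_nonneg hdθ.le, ← hnum θ]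
    calc ‖P.eval (unitPoint θ) + c * β‖ / d θ
        ≤ ‖P.eval (unitPoint θ) + c * β‖ / (t * ‖B.eval (unitPoint θ)⁻¹‖) := by
          gcongr
          exact hden θ
      _ = _ := by field_simp
  have hgbound : ∀ᵐ θ : ℝ, g (unitPoint θ)⁻¹ ≤ 2 ^ p := by
    filter_upwards [hBae] with θ hθ
    refine Real.rpow_le_rpow (norm_nonneg _) ((norm_add_le _ _).trans ?_) hp.le
    have h1 := hAB _ (hun θ).le
    rw [hun, mul_one] at h1
    have h2 : ‖A.eval (unitPoint θ)⁻¹ / B.eval (unitPoint θ)⁻¹‖ ≤ 1 := by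
      rw [norm_div, div_le_one₀ (norm_pos_iff.mpr hθ)]
      exact h1.trans (mul_le_of_le_one_left (norm_nonneg _) hkμ1)
    rw [norm_one]
    linarith
  have hum : Measurable unitPoint := continuous_unitPoint.measurable
  have hgm : Measurable fun θ : ℝ ↦ g (unitPoint θ)⁻¹ :=
    (((A.continuous.measurable.comp hum.inv).div (B.continuous.measurable.comp hum.inv)).const_add 1).norm.pow_const p
  have hdm : Measurable d := ((polarDerivative α P).continuous.measurable.comp hum).norm.sub_const _
  have hqm : Measurable q :=
    (((P.continuous.measurable.comp hum).add_const _).div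
      (Complex.measurable_ofReal.comp hdm)).norm.pow_const p
  have hq0 : ∀ θ, 0 ≤ q θ := fun θ ↦ Real.rpow_nonneg (norm_nonneg _) _
  have hg0 : ∀ z, 0 ≤ g z := fun z ↦ Real.rpow_nonneg (norm_nonneg _) _
  have hgint : IntervalIntegrable (fun θ : ℝ ↦ g (unitPoint θ)⁻¹) MeasureTheory.volume
      0 (2 * Real.pi) := by
    refine (intervalIntegrable_const (c := (2 : ℝ) ^ p)).mono_fun hgm.aestronglyMeasurable ?_
    refine MeasureTheory.ae_restrict_of_ae ?_
    filter_upwards [hgbound] with θ hθ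
    rwa [Real.norm_of_nonneg (hg0 _), Real.norm_of_nonneg (by positivity)]
  have hqint : IntervalIntegrable q MeasureTheory.volume 0 (2 * Real.pi) := by
    refine (hgint.const_mul (((n * t)⁻¹) ^ p)).mono_fun hqm.aestronglyMeasurable ?_
    refine MeasureTheory.ae_restrict_of_ae ?_
    filter_upwards [hqg] with θ hθ
    have h0 : 0 ≤ ((n * t)⁻¹) ^ p * g (unitPoint θ)⁻¹ := mul_nonneg (by positivity) (hg0 _)
    rwa [Real.norm_of_nonneg (hq0 _), Real.norm_of_nonneg h0]
  refine ⟨fun _ ↦ ⟨hdpos.mono fun θ h ↦ h.ne', hqint⟩, ?_⟩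
  -- `w = 1/z` runs over the same circle, so inversion preserves the mean.
  have hinv : ∫ θ in (0 : ℝ)..(2 * Real.pi), g (unitPoint θ)⁻¹
      = ∫ θ in (0 : ℝ)..(2 * Real.pi), g (unitPoint θ) := by
    have h := Real.circleAverage_zero_one_congr_inv (f := g)
    rw [Real.circleAverage_def, Real.circleAverage_def] at h
    simp only [← unitPoint_eq_circleMap] at h
    exact smul_right_injective ℝ (inv_ne_zero (by positivity : (2 * Real.pi : ℝ) ≠ 0)) h
  have hsub := integral_norm_one_add_div_rpow_le (pow_nonneg hk0 μ) hkμ1 hp hBne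
    fun z hz ↦ hAB z hz.le
  have hIle : ∫ θ in (0 : ℝ)..(2 * Real.pi), q θ ≤ ((n * t)⁻¹) ^ p * J := by
    calc ∫ θ in (0 : ℝ)..(2 * Real.pi), q θ
        ≤ ∫ θ in (0 : ℝ)..(2 * Real.pi), ((n * t)⁻¹) ^ p * g (unitPoint θ)⁻¹ :=
          intervalIntegral.integral_mono_ae hpi hqint (hgint.const_mul _) hqg
      _ = ((n * t)⁻¹) ^ p * ∫ θ in (0 : ℝ)..(2 * Real.pi), g (unitPoint θ) := by
          rw [intervalIntegral.integral_const_mul, hinv]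
      _ ≤ ((n * t)⁻¹) ^ p * J := by
          gcongr
          rw [hJ]
          push_cast at hsub
          exact hsub
  have hI0 : 0 ≤ ∫ θ in (0 : ℝ)..(2 * Real.pi), q θ :=
    intervalIntegral.integral_nonneg hpi fun θ _ ↦ hq0 θ
  have hnt : 0 < n * t := by positivity
  calc n * t * (∫ θ in (0 : ℝ)..(2 * Real.pi), q θ) ^ (1 / p)
      ≤ n * t * (((n * t)⁻¹) ^ p * J) ^ (1 / p) := by gcongr
    _ = n * t * ((n * t)⁻¹ * J ^ (1 / p)) := by
        rw [Real.mul_rpow (by positivity) hJ0, ← Real.rpow_mul (by positivity),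
          mul_one_div_cancel hp.ne', Real.rpow_one]
    _ = J ^ (1 / p) := mul_inv_cancel_left₀ hnt.ne' _
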